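/- Model. Let $\mathcal T=\gamma\,\mathbf w\otimes\mathbf u\otimes\mathbf v+\mathcal Z$ be a random $m_1\times m_2\times m_3$ real tensor, with $\gamma>0$, unit vectors $\mathbf w\in\mathbb R^{m_1}$, $\mathbf u\in\mathbb R^{m_2}$, $\mathbf v\in\mathbb R^{m_3}$, and index sets $J_s\subset[m_s]$ such that $\gamma\,\mathbf w(i)\mathbf u(j)\mathbf v(k)=0$ for $(i,j,k)\notin J_1\times J_2\times J_3$. The noise entries $\mathcal Z_{ijk}$ are random variables, and those with $i\notin J_1$ are i.i.d. standard normal (the noise in the slices $i\in J_1$ is arbitrary). Put $l=|J_1|$ and assume $l<m_1$. Let $T_i=\mathcal T(i,:,:)$ and $C_i=T_i^tT_i$. Let $\underline\lambda_i$ be the largest eigenvalue of $C_i$, $\tilde{\mathbf v}_i$ a unit eigenvector of $C_i$ for $\underline\lambda_i$, $\lambda=\max_i\underline\lambda_i$, $\tilde\lambda_i=\underline\lambda_i/\lambda$, $c_{ij}=|\langle\tilde\lambda_i\tilde{\mathbf v}_i,\tilde\lambda_j\tilde{\mathbf v}_j\rangle|$ and $d_i=\sum_{j\in[m_1]}c_{ij}$.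 For nonempty finite sets $A,B\subset\mathbb R$ let $\mathrm{dist}(A,B)=\min\{|x-y|:x\in A,\,y\in B\}$, and let $d(J_1)=\{d_i:i\in J_1\}$ and $d(\bar J_1)=\{d_i:i\in[m_1]\setminus J_1\}$. Let $\mu=(\sqrt{m_2-1}+\sqrt{m_3})^2$ if $m_3\le m_2$, and $\mu=(\sqrt{m_3-1}+\sqrt{m_2})^2$ otherwise. Statement. For all constants $c,K>0$ there is a constant $c_1>0$, depending only on $c$ and $K$, such that for every such model with $\log m_1\le K(m_2+m_3)$ and for every $\varepsilon>0$ there is an event of probability at least $1-e\,(m_1-l)^{-c_1}$ on which the following holds for every choice of the top eigenvectors $\tilde{\mathbf v}_i$: if $\lambda\ge c\,\mu\,m_1$, and if the slices in $J_1$ are pairwise $\varepsilon$-similar, that is, $c_{ij}\ge 1-\varepsilon/2$ for all $i,j\in J_1$, then $$\mathrm{dist}\bigl(d(J_1),d(\bar J_1)\bigr)\ \ge\ l\Bigl(1-\frac{\varepsilon}{2}-\frac1{m_1}\Bigr)-\sqrt{\log(m_1-l)}.$$ -/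

import Mathlib

open MeasureTheory ProbabilityTheory

noncomputable section

namespace MultiSlice

/-- The rank-one triclustering model `𝒯 = γ w ⊗ u ⊗ v + 𝒵` of a random `m₁ × m₂ × m₃` tensor
with planted cluster `J₁ × J₂ × J₃`: the signal is `γ w ⊗ u ⊗ v` with `γ > 0` and unit vectors
`w, u, v`, it vanishes outside `J₁ × J₂ × J₃`, and the noise entries of the horizontal slices
`i ∉ J₁` are i.i.d. standard normal. On the noise in the slices `i ∈ J₁` nothing but measurability
is required (in particular it may be i.i.d. standard normal as well). -/
structure TriclusterModel {Ω : Type*} [MeasurableSpace Ω] (P : Measure Ω) {m₁ m₂ m₃ : ℕ}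
    (J₁ : Finset (Fin m₁)) (J₂ : Finset (Fin m₂)) (J₃ : Finset (Fin m₃)) where
  /-- signal strength -/
  γ : ℝ
  w : EuclideanSpace ℝ (Fin m₁)
  u : EuclideanSpace ℝ (Fin m₂)
  v : EuclideanSpace ℝ (Fin m₃)
  /-- noise tensor -/
  Z : Fin m₁ → Fin m₂ → Fin m₃ → Ω → ℝ
  γ_pos : 0 < γ
  norm_w : ‖w‖ = 1
  norm_u : ‖u‖ = 1
  norm_v : ‖v‖ = 1
  signal_eq_zero : ∀ i j k, ¬ (i ∈ J₁ ∧ j ∈ J₂ ∧ k ∈ J₃) → γ * (w i * u j * v k) = 0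
  measurable_noise : ∀ i j k, Measurable (Z i j k)
  noise_law : ∀ i j k, i ∉ J₁ → P.map (Z i j k) = gaussianReal 0 1
  noise_indep :
    iIndepFun (fun x : {x : Fin m₁ × Fin m₂ × Fin m₃ // x.1 ∉ J₁} => Z x.1.1 x.1.2.1 x.1.2.2) P

/-- The top (largest) eigenvalue of a real symmetric matrix. -/
def topEigenvalue {n : ℕ} (A : Matrix (Fin n) (Fin n) ℝ) : ℝ :=
  sSup {x : ℝ | Module.End.HasEigenvalue (Matrix.toLin' A) x}

/-- `x` is a unit eigenvector of `A` for its top eigenvalue. -/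
def IsTopEigenvector {n : ℕ} (A : Matrix (Fin n) (Fin n) ℝ) (x : EuclideanSpace ℝ (Fin n)) :
    Prop :=
  ‖x‖ = 1 ∧ A.mulVec x.ofLp = topEigenvalue A • x.ofLp

/-- The centering constant `μ = (√(m₂ - 1) + √m₃)²` of the top eigenvalue of a white Wishart
matrix, for `m₃ ≤ m₂`; the roles of `m₂` and `m₃` are reversed for `m₂ < m₃`. -/
def wishartMu (m₂ m₃ : ℕ) : ℝ :=
  if m₃ ≤ m₂ then (√((m₂ : ℝ) - 1) + √(m₃ : ℝ)) ^ 2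
  else (√((m₃ : ℝ) - 1) + √(m₂ : ℝ)) ^ 2

/-- The distance `min {|x - y| : x ∈ A, y ∈ B}` between two finite nonempty sets of reals. -/
def setDist (A B : Set ℝ) : ℝ :=
  sInf {r : ℝ | ∃ x ∈ A, ∃ y ∈ B, r = |x - y|}

namespace TriclusterModel

variable {Ω : Type*} [MeasurableSpace Ω] {P : Measure Ω} {m₁ m₂ m₃ : ℕ}
  {J₁ : Finset (Fin m₁)} {J₂ : Finset (Fin m₂)} {J₃ : Finset (Fin m₃)}

/-- The horizontal slice `T_i = 𝒯(i, :, :)` of the data tensor. -/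
def slice (M : TriclusterModel P J₁ J₂ J₃) (ω : Ω) (i : Fin m₁) :
    Matrix (Fin m₂) (Fin m₃) ℝ :=
  Matrix.of fun j k => M.γ * (M.w i * M.u j * M.v k) + M.Z i j k ω

/-- `C_i = T_iᵗ T_i`. -/
def sliceCov (M : TriclusterModel P J₁ J₂ J₃) (ω : Ω) (i : Fin m₁) :
    Matrix (Fin m₃) (Fin m₃) ℝ :=
  (M.slice ω i).transpose * M.slice ω i

/-- `λ`, the maximum over all slices of the top eigenvalues of the `C_i`. -/
def maxEigenvalue (M : TriclusterModel P J₁ J₂ J₃) (ω : Ω) : ℝ :=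
  ⨆ i : Fin m₁, topEigenvalue (M.sliceCov ω i)

/-- The normalized top eigenvalue of `C_i`. -/
def normEigenvalue (M : TriclusterModel P J₁ J₂ J₃) (ω : Ω) (i : Fin m₁) : ℝ :=
  topEigenvalue (M.sliceCov ω i) / M.maxEigenvalue ω

/-- The entries `c_ij` of the matrix `C`, for a family `x` of top eigenvectors of the `C_i`. -/
def sim (M : TriclusterModel P J₁ J₂ J₃) (ω : Ω) (x : Fin m₁ → EuclideanSpace ℝ (Fin m₃))
    (i j : Fin m₁) : ℝ :=
  |inner ℝ (M.normEigenvalue ω i • x i) (M.normEigenvalue ω j • x j)|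

/-- The slices `i` and `j` are `ε`-similar. -/
def EpsSimilar (M : TriclusterModel P J₁ J₂ J₃) (ω : Ω)
    (x : Fin m₁ → EuclideanSpace ℝ (Fin m₃)) (ε : ℝ) (i j : Fin m₁) : Prop :=
  1 - ε / 2 ≤ M.sim ω x i j

/-- The marginal sum `d_i` of the matrix `C`. -/
def marginal (M : TriclusterModel P J₁ J₂ J₃) (ω : Ω)
    (x : Fin m₁ → EuclideanSpace ℝ (Fin m₃)) (i : Fin m₁) : ℝ :=
  ∑ j, M.sim ω x i j

end TriclusterModel

end MultiSlice

end

/-! Off the cluster a slice is pure Gaussian noise, and with n = m₂ + m₃ its operator norm is O(√n),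
with constant depending on K. Indeed a bilinear form tested on `1/2`-nets of the unit balls has
Gaussian tails, and a union over the nets and all such slices costs only a factor exponential in n,
because log m₁ ≤ K n (`exists_event_norm_slice_le`). Since μ ≥ n / 2, the top eigenvalue of such a
slice is O(μ). Dividing by λ ≥ c μ m₁ makes its normalized eigenvalue at most B / m₁ with B
depending only on c and K. This eigenvalue bounds every entry of its row of similarities, so d_j ≤ B
off J₁. On J₁, similarity alone gives d_i ≥ l (1 - ε / 2). If B ≤ √(log (m₁ - l)), the gap follows.
Otherwise m₁ - l is bounded, and c₁ is chosen so small that the probability claim is vacuous. -/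

open scoped NNReal

namespace MultiSlice

/-! ### Nets and operator norms -/

/-- In a finite-dimensional space the unit ball has a `1/2`-net with at most `5 ^ dim` points. -/
theorem exists_half_net (V : Type*) [NormedAddCommGroup V] [NormedSpace ℝ V]
    [FiniteDimensional ℝ V] :
    ∃ N : Finset V, N.card ≤ 5 ^ Module.finrank ℝ V ∧ (∀ y ∈ N, ‖y‖ ≤ 1) ∧
      ∀ x : V, ‖x‖ ≤ 1 → ∃ y ∈ N, ‖x - y‖ ≤ 1 / 2 := by
  classical
  -- A `1`-separated set of maximal size in the ball of radius 2 is a `1`-net, as any missed point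
  -- could be added. The packing bound is stated at this scale, so the set is halved afterwards.
  let S : Set ℕ := {n | ∃ s : Finset V, s.card = n ∧ (∀ c ∈ s, ‖c‖ ≤ 2) ∧
    ∀ c ∈ s, ∀ d ∈ s, c ≠ d → 1 ≤ ‖c - d‖}
  have hbdd : BddAbove S := by
    refine ⟨5 ^ Module.finrank ℝ V, ?_⟩
    rintro _ ⟨s, rfl, h1, h2⟩
    exact Besicovitch.card_le_of_separated s h1 h2
  obtain ⟨s, hcard, h1, h2⟩ := Nat.sSup_mem (s := S) ⟨0, ∅, by simp⟩ hbdd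
  refine ⟨s.image fun y => (1 / 2 : ℝ) • y,
    Finset.card_image_le.trans (Besicovitch.card_le_of_separated s h1 h2), ?_, ?_⟩
  · intro y hy
    obtain ⟨c, hc, rfl⟩ := Finset.mem_image.1 hy
    rw [norm_smul]
    norm_num
    linarith [h1 c hc]
  · intro x hx
    have hx2 : ‖(2 : ℝ) • x‖ ≤ 2 := by
      rw [norm_smul]
      norm_num
      exact hx
    have key : ∃ c ∈ s, ‖(2 : ℝ) • x - c‖ ≤ 1 := by
      by_contra! hcon
      have hnot : (2 : ℝ) • x ∉ s := by
        intro h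
        have := hcon _ h
        simp at this
        linarith
      have hmem : s.card + 1 ∈ S := by
        refine ⟨insert ((2 : ℝ) • x) s, Finset.card_insert_of_notMem hnot, ?_, ?_⟩
        · intro c hc
          rcases Finset.mem_insert.1 hc with rfl | hc
          exacts [hx2, h1 c hc]
        · intro c hc d hd hcd
          rcases Finset.mem_insert.1 hc with rfl | hc <;>
            rcases Finset.mem_insert.1 hd with rfl | hd
          · exact absurd rfl hcd
          · exact (hcon d hd).le
          · rw [norm_sub_rev]
            exact (hcon c hc).le
          · exact h2 c hc d hd hcd
      have := le_csSup hbdd hmem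
      omega
    obtain ⟨c, hc, hxc⟩ := key
    refine ⟨(1 / 2 : ℝ) • c, Finset.mem_image_of_mem _ hc, ?_⟩
    have : x - (1 / 2 : ℝ) • c = (1 / 2 : ℝ) • ((2 : ℝ) • x - c) := by
      rw [smul_sub, smul_smul]
      norm_num
    rw [this, norm_smul]
    norm_num
    linarith

/-- Control of a bilinear form on `1/2`-nets bounds the operator norm. -/
theorem norm_le_of_inner_le_on_half_nets {V W : Type*}
    [NormedAddCommGroup V] [NormedSpace ℝ V] [NormedAddCommGroup W] [InnerProductSpace ℝ W]
    {N : Set V} {N' : Set W}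
    (hN : ∀ x : V, ‖x‖ ≤ 1 → ∃ y ∈ N, ‖x - y‖ ≤ 1 / 2)
    (hN' : ∀ x : W, ‖x‖ ≤ 1 → ∃ y ∈ N', ‖x - y‖ ≤ 1 / 2)
    (f : V →L[ℝ] W) {t : ℝ} (ht : 0 ≤ t)
    (h : ∀ y ∈ N, ∀ z ∈ N', inner ℝ z (f y) ≤ t) : ‖f‖ ≤ 4 * t := by
  have step : ∀ y ∈ N, ‖f y‖ ≤ 2 * t := by
    intro y hy
    by_cases h0 : f y = 0
    · simpa [h0] using ht
    have hpos : 0 < ‖f y‖ := norm_pos_iff.2 h0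
    set e : W := ‖f y‖⁻¹ • f y
    have he : ‖e‖ = 1 := by
      simp only [e, norm_smul, norm_inv, norm_norm]
      exact inv_mul_cancel₀ hpos.ne'
    obtain ⟨z, hz, hez⟩ := hN' e he.le
    have h1 : inner ℝ e (f y) = ‖f y‖ := by
      simp only [e, real_inner_smul_left, real_inner_self_eq_norm_sq]
      field_simp
    have h2 : inner ℝ (e - z) (f y) ≤ 1 / 2 * ‖f y‖ :=
      (real_inner_le_norm _ _).trans (mul_le_mul_of_nonneg_right hez hpos.le)
    rw [inner_sub_left, h1] at h2
    linarith [h y hy z hz]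
  -- The net error is again controlled by `‖f‖`, with factor `1/2`, so it can be absorbed on the
  -- left.
  have hle : ‖f‖ ≤ 2 * t + ‖f‖ / 2 := by
    refine f.opNorm_le_of_unit_norm (by positivity) fun x hx => ?_
    obtain ⟨y, hy, hxy⟩ := hN x hx.le
    calc ‖f x‖ = ‖f y + f (x - y)‖ := by rw [map_sub, add_sub_cancel]
      _ ≤ ‖f y‖ + ‖f (x - y)‖ := norm_add_le _ _
      _ ≤ 2 * t + ‖f‖ * (1 / 2) :=
          add_le_add (step y hy) ((f.le_opNorm _).trans
            (mul_le_mul_of_nonneg_left hxy (norm_nonneg f)))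
      _ = 2 * t + ‖f‖ / 2 := by ring
  linarith

/-! ### Gaussian tails -/

theorem hasSubgaussianMGF_of_map_eq_gaussianReal {Ω : Type*} [MeasurableSpace Ω] {P : Measure Ω}
    {X : Ω → ℝ} (hX : AEMeasurable X P) (h : P.map X = gaussianReal 0 1) :
    HasSubgaussianMGF X 1 P := by
  have hid : HasSubgaussianMGF id 1 (P.map X) := by
    rw [h]
    refine ⟨fun t => integrable_exp_mul_gaussianReal t, fun t => ?_⟩
    rw [mgf_id_gaussianReal]
    simp
  exact HasSubgaussianMGF.of_map (X := id) hX hid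

/-- A Gaussian matrix, evaluated as a bilinear form on the unit balls, has Gaussian tails. -/
theorem measureReal_le_inner_toEuclideanLin {Ω : Type*} [MeasurableSpace Ω] {P : Measure Ω}
    {m n : ℕ} {G : Fin m → Fin n → Ω → ℝ} (hG : ∀ j k, AEMeasurable (G j k) P)
    (hlaw : ∀ j k, P.map (G j k) = gaussianReal 0 1)
    (hind : iIndepFun (fun q : Fin m × Fin n => G q.1 q.2) P)
    {y : EuclideanSpace ℝ (Fin n)} {z : EuclideanSpace ℝ (Fin m)} (hy : ‖y‖ ≤ 1) (hz : ‖z‖ ≤ 1)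
    {t : ℝ} (ht : 0 ≤ t) :
    P.real {ω | t < inner ℝ z ((Matrix.of fun j k => G j k ω).toEuclideanLin y)}
      ≤ Real.exp (-t ^ 2 / 2) := by
  have hP : IsProbabilityMeasure P := hind.isProbabilityMeasure
  have hexp : ∀ ω, inner ℝ z ((Matrix.of fun j k => G j k ω).toEuclideanLin y)
      = ∑ q : Fin m × Fin n, (z q.1 * y q.2) * G q.1 q.2 ω := by
    intro ω
    simp only [PiLp.inner_apply, Matrix.ofLp_toLpLin, Matrix.toLin'_apply, Matrix.mulVec,
      dotProduct, Fintype.sum_prod_type, Matrix.of_apply, RCLike.inner_apply, conj_trivial, Finset.sum_mul]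
    exact Finset.sum_congr rfl fun j _ => Finset.sum_congr rfl fun k _ => by ring
  have hind' : iIndepFun (fun (q : Fin m × Fin n) ω => (z q.1 * y q.2) * G q.1 q.2 ω) P :=
    hind.comp (fun q x => (z q.1 * y q.2) * x) fun q => measurable_const_mul _
  have hsub := HasSubgaussianMGF.sum_of_iIndepFun hind' (s := Finset.univ)
    fun q _ => (hasSubgaussianMGF_of_map_eq_gaussianReal (hG q.1 q.2)
      (hlaw q.1 q.2)).const_mul (z q.1 * y q.2)
  have hvar : ∑ q : Fin m × Fin n, (z q.1 * y q.2) ^ 2 ≤ 1 := by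
    have : ∑ q : Fin m × Fin n, (z q.1 * y q.2) ^ 2 = ‖z‖ ^ 2 * ‖y‖ ^ 2 := by
      rw [EuclideanSpace.real_norm_sq_eq, EuclideanSpace.real_norm_sq_eq, Finset.sum_mul_sum,
        Fintype.sum_prod_type]
      exact Finset.sum_congr rfl fun j _ => Finset.sum_congr rfl fun k _ => by ring
    rw [this]
    exact mul_le_one₀ (pow_le_one₀ (norm_nonneg _) hz) (by positivity)
      (pow_le_one₀ (norm_nonneg _) hy)
  -- The variance proxy `‖z‖² ‖y‖²` is enlarged to 1, which makes the tail uniform over the nets.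
  have hsub1 : HasSubgaussianMGF
      (fun ω => ∑ q : Fin m × Fin n, (z q.1 * y q.2) * G q.1 q.2 ω) 1 P := by
    refine ⟨hsub.integrable_exp_mul, fun s => (hsub.mgf_le s).trans ?_⟩
    refine Real.exp_le_exp.2 ?_
    have : ((∑ q : Fin m × Fin n, (⟨(z q.1 * y q.2) ^ 2, sq_nonneg _⟩ * 1 : ℝ≥0) : ℝ≥0) : ℝ)
        ≤ ((1 : ℝ≥0) : ℝ) := by
      rw [NNReal.coe_sum]
      refine le_trans (Finset.sum_le_sum fun q _ => ?_) hvar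
      exact (mul_one ((z q.1 * y q.2) ^ 2)).le
    gcongr
  calc P.real {ω | t < inner ℝ z ((Matrix.of fun j k => G j k ω).toEuclideanLin y)}
      ≤ P.real {ω | t ≤ ∑ q : Fin m × Fin n, (z q.1 * y q.2) * G q.1 q.2 ω} := by
        refine measureReal_mono fun ω hω => ?_
        simp only [Set.mem_ofPred_eq, hexp] at hω ⊢
        exact hω.le
    _ ≤ Real.exp (-t ^ 2 / 2) := by simpa using hsub1.measure_ge_le ht

/-! ### Top eigenvalues and the centering constant -/

/-- The top eigenvalue of `Aᵗ A` is the squared norm of the image of a top eigenvector. -/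
theorem topEigenvalue_transpose_mul_self {m n : ℕ} (A : Matrix (Fin m) (Fin n) ℝ)
    {x : EuclideanSpace ℝ (Fin n)} (hx : IsTopEigenvector (A.transpose * A) x) :
    topEigenvalue (A.transpose * A) = ‖A.toEuclideanLin x‖ ^ 2 := by
  obtain ⟨hx1, hx2⟩ := hx
  have h1 : x.ofLp ⬝ᵥ x.ofLp = 1 := by
    have := EuclideanSpace.real_norm_sq_eq x
    rw [hx1] at this
    simp only [dotProduct, ← sq]
    linarith
  have h2 : x.ofLp ⬝ᵥ (A.transpose * A).mulVec x.ofLp = A.mulVec x.ofLp ⬝ᵥ A.mulVec x.ofLp := by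
    rw [← Matrix.mulVec_mulVec, Matrix.dotProduct_mulVec, Matrix.vecMul_transpose]
  rw [hx2, dotProduct_smul, h1, smul_eq_mul, mul_one] at h2
  rw [h2, EuclideanSpace.real_norm_sq_eq]
  simp only [dotProduct, ← sq, Matrix.ofLp_toLpLin, Matrix.toLin'_apply]

/-- Dropping the cross term of the square leaves m₂ + m₃ - 1; the factor 1/2 absorbs the -1, with
equality at m₂ = m₃ = 1. -/
theorem half_add_le_wishartMu {m₂ m₃ : ℕ} (h₂ : 0 < m₂) (h₃ : 0 < m₃) :
    ((m₂ : ℝ) + m₃) / 2 ≤ wishartMu m₂ m₃ := by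
  have h₂' : (1 : ℝ) ≤ m₂ := by exact_mod_cast h₂
  have h₃' : (1 : ℝ) ≤ m₃ := by exact_mod_cast h₃
  have key : ∀ a b : ℝ, 1 ≤ a → 1 ≤ b → (a + b) / 2 ≤ (√(a - 1) + √b) ^ 2 := by
    intro a b ha hb
    have e1 := Real.sq_sqrt (show 0 ≤ a - 1 by linarith)
    have e2 := Real.sq_sqrt (show 0 ≤ b by linarith)
    have e3 := mul_nonneg (Real.sqrt_nonneg (a - 1)) (Real.sqrt_nonneg b)
    nlinarith
  unfold wishartMu
  split_ifs
  · exact key _ _ h₂' h₃'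
  · rw [add_comm (m₂ : ℝ)]
    exact key _ _ h₃' h₂'

/-! ### Noise slices of the model -/

namespace TriclusterModel

variable {Ω : Type*} [MeasurableSpace Ω] {P : Measure Ω} {m₁ m₂ m₃ : ℕ}
  {J₁ : Finset (Fin m₁)} {J₂ : Finset (Fin m₂)} {J₃ : Finset (Fin m₃)}

theorem exists_mem (M : TriclusterModel P J₁ J₂ J₃) :
    ∃ i j k, i ∈ J₁ ∧ j ∈ J₂ ∧ k ∈ J₃ := by
  have aux : ∀ {n : ℕ} (x : EuclideanSpace ℝ (Fin n)), ‖x‖ = 1 → ∃ i, x i ≠ 0 := by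
    intro n x hx
    by_contra! h
    have : x = 0 := by
      ext i
      simpa using h i
    simp [this] at hx
  obtain ⟨i, hi⟩ := aux M.w M.norm_w
  obtain ⟨j, hj⟩ := aux M.u M.norm_u
  obtain ⟨k, hk⟩ := aux M.v M.norm_v
  refine ⟨i, j, k, ?_⟩
  by_contra h
  exact mul_ne_zero M.γ_pos.ne' (mul_ne_zero (mul_ne_zero hi hj) hk) (M.signal_eq_zero i j k h)

theorem slice_of_notMem (M : TriclusterModel P J₁ J₂ J₃) (ω : Ω) {i : Fin m₁} (hi : i ∉ J₁) :
    M.slice ω i = Matrix.of fun j k => M.Z i j k ω := by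
  ext j k
  simp [slice, M.signal_eq_zero i j k fun h => hi h.1]

theorem measurable_inner_slice (M : TriclusterModel P J₁ J₂ J₃) (i : Fin m₁)
    (y : EuclideanSpace ℝ (Fin m₃)) (z : EuclideanSpace ℝ (Fin m₂)) :
    Measurable fun ω => inner ℝ z ((M.slice ω i).toEuclideanLin y) := by
  simp only [PiLp.inner_apply, Matrix.ofLp_toLpLin, Matrix.toLin'_apply, Matrix.mulVec, dotProduct,
    slice, Matrix.of_apply, RCLike.inner_apply, conj_trivial]
  have := M.measurable_noise
  fun_prop

theorem measureReal_le_inner_slice (M : TriclusterModel P J₁ J₂ J₃) {i : Fin m₁} (hi : i ∉ J₁)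
    {y : EuclideanSpace ℝ (Fin m₃)} {z : EuclideanSpace ℝ (Fin m₂)} (hy : ‖y‖ ≤ 1) (hz : ‖z‖ ≤ 1)
    {t : ℝ} (ht : 0 ≤ t) :
    P.real {ω | t < inner ℝ z ((M.slice ω i).toEuclideanLin y)} ≤ Real.exp (-t ^ 2 / 2) := by
  simp only [M.slice_of_notMem _ hi]
  refine measureReal_le_inner_toEuclideanLin (fun j k => (M.measurable_noise i j k).aemeasurable)
    (fun j k => M.noise_law i j k hi) ?_ hy hz ht
  -- Only independence within one slice is needed; different slices are combined by a union bound.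
  let g : Fin m₂ × Fin m₃ → {x : Fin m₁ × Fin m₂ × Fin m₃ // x.1 ∉ J₁} := fun q => ⟨(i, q), hi⟩
  have hg : Function.Injective g := fun a b hab => (Prod.ext_iff.1 (Subtype.ext_iff.1 hab)).2
  exact M.noise_indep.precomp hg

/-- All slices off the cluster have operator norm at most `4 * t`, up to an event whose probability is
bounded by a union over `1/2`-nets. -/
theorem exists_event_norm_slice_le (M : TriclusterModel P J₁ J₂ J₃) [IsProbabilityMeasure P]
    {t : ℝ} (ht : 0 ≤ t) :
    ∃ E : Set Ω, MeasurableSet E ∧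
      1 - ((m₁ : ℝ) - J₁.card) * (5 ^ (m₂ + m₃) * Real.exp (-t ^ 2 / 2)) ≤ P.real E ∧
      ∀ ω ∈ E, ∀ i ∉ J₁, ∀ x, ‖(M.slice ω i).toEuclideanLin x‖ ≤ 4 * t * ‖x‖ := by
  classical
  obtain ⟨N, hNc, hN1, hN⟩ := exists_half_net (EuclideanSpace ℝ (Fin m₃))
  obtain ⟨N', hNc', hN1', hN'⟩ := exists_half_net (EuclideanSpace ℝ (Fin m₂))
  rw [finrank_euclideanSpace, Fintype.card_fin] at hNc hNc'
  let I : Finset (Fin m₁ × EuclideanSpace ℝ (Fin m₃) × EuclideanSpace ℝ (Fin m₂)) :=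
    J₁ᶜ ×ˢ N ×ˢ N'
  let bad : Fin m₁ × EuclideanSpace ℝ (Fin m₃) × EuclideanSpace ℝ (Fin m₂) → Set Ω :=
    fun a => {ω | t < inner ℝ a.2.2 ((M.slice ω a.1).toEuclideanLin a.2.1)}
  have hmeas : MeasurableSet (⋃ a ∈ I, bad a) := Finset.measurableSet_biUnion _ fun a _ =>
    measurableSet_lt measurable_const (M.measurable_inner_slice a.1 a.2.1 a.2.2)
  refine ⟨(⋃ a ∈ I, bad a)ᶜ, hmeas.compl, ?_, ?_⟩
  · rw [probReal_compl_eq_one_sub hmeas]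
    refine sub_le_sub_left ?_ 1
    have hIcard : (I.card : ℝ) ≤ ((m₁ : ℝ) - J₁.card) * 5 ^ (m₂ + m₃) := by
      have h1 : ((J₁ᶜ.card : ℕ) : ℝ) = (m₁ : ℝ) - J₁.card := by
        rw [Finset.card_compl, Fintype.card_fin, Nat.cast_sub]
        simpa using J₁.card_le_univ
      have h2 : N.card * N'.card ≤ 5 ^ (m₂ + m₃) := by
        rw [add_comm, pow_add]
        exact Nat.mul_le_mul hNc hNc'
      have h3 : ((N.card * N'.card : ℕ) : ℝ) ≤ 5 ^ (m₂ + m₃) := by exact_mod_cast h2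
      rw [Finset.card_product, Finset.card_product, Nat.cast_mul, h1]
      refine mul_le_mul_of_nonneg_left h3 ?_
      rw [← h1]
      positivity
    calc P.real (⋃ a ∈ I, bad a) ≤ ∑ a ∈ I, P.real (bad a) := measureReal_biUnion_finset_le _ _
      _ ≤ ∑ a ∈ I, Real.exp (-t ^ 2 / 2) := by
          refine Finset.sum_le_sum fun a ha => ?_
          simp only [I, Finset.mem_product, Finset.mem_compl] at ha
          exact M.measureReal_le_inner_slice ha.1 (hN1 _ ha.2.1) (hN1' _ ha.2.2) ht
      _ = I.card * Real.exp (-t ^ 2 / 2) := by rw [Finset.sum_const, nsmul_eq_mul]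
      _ ≤ ((m₁ : ℝ) - J₁.card) * 5 ^ (m₂ + m₃) * Real.exp (-t ^ 2 / 2) :=
          mul_le_mul_of_nonneg_right hIcard (Real.exp_pos _).le
      _ = _ := mul_assoc _ _ _
  · intro ω hω i hi x
    have hf := norm_le_of_inner_le_on_half_nets (N := N) (N' := N') (by exact_mod_cast hN)
      (by exact_mod_cast hN') (LinearMap.toContinuousLinearMap (M.slice ω i).toEuclideanLin) ht
      (by
        intro y hy z hz
        by_contra! hlt
        refine hω (Set.mem_biUnion (x := (i, y, z)) ?_ hlt)
        simp only [I, Finset.coe_product, Set.mem_prod, Finset.mem_coe, Finset.mem_compl]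
        exact ⟨hi, hy, hz⟩)
    exact (ContinuousLinearMap.le_opNorm _ x).trans
      (mul_le_mul_of_nonneg_right hf (norm_nonneg x))

/-! ### Deterministic bounds on the marginals -/

section Deterministic

variable (M : TriclusterModel P J₁ J₂ J₃) (ω : Ω) {x : Fin m₁ → EuclideanSpace ℝ (Fin m₃)}

theorem topEigenvalue_sliceCov (hx : ∀ i, IsTopEigenvector (M.sliceCov ω i) (x i)) (i : Fin m₁) :
    topEigenvalue (M.sliceCov ω i) = ‖(M.slice ω i).toEuclideanLin (x i)‖ ^ 2 :=
  topEigenvalue_transpose_mul_self _ (hx i)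

theorem normEigenvalue_nonneg (hx : ∀ i, IsTopEigenvector (M.sliceCov ω i) (x i))
    (hpos : 0 < M.maxEigenvalue ω) (i : Fin m₁) : 0 ≤ M.normEigenvalue ω i := by
  rw [normEigenvalue, M.topEigenvalue_sliceCov ω hx]
  positivity

theorem normEigenvalue_le_one (hpos : 0 < M.maxEigenvalue ω) (i : Fin m₁) :
    M.normEigenvalue ω i ≤ 1 :=
  (div_le_one hpos).2
    (le_ciSup (f := fun i => topEigenvalue (M.sliceCov ω i)) (Set.finite_range _).bddAbove i)

theorem sim_nonneg (i j : Fin m₁) : 0 ≤ M.sim ω x i j := abs_nonneg _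

/-- Cauchy–Schwarz gives the product of both normalized eigenvalues; the one for `j` is at most 1.
-/
theorem sim_le_normEigenvalue (hx : ∀ i, IsTopEigenvector (M.sliceCov ω i) (x i))
    (hpos : 0 < M.maxEigenvalue ω) (i j : Fin m₁) : M.sim ω x i j ≤ M.normEigenvalue ω i := by
  have h0 := M.normEigenvalue_nonneg ω hx hpos
  refine (abs_real_inner_le_norm _ _).trans ?_
  rw [norm_smul, norm_smul, (hx i).1, (hx j).1, mul_one, mul_one, Real.norm_of_nonneg (h0 i),
    Real.norm_of_nonneg (h0 j)]
  exact mul_le_of_le_one_right (h0 i) (M.normEigenvalue_le_one ω hpos j)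

theorem marginal_le (hx : ∀ i, IsTopEigenvector (M.sliceCov ω i) (x i))
    (hpos : 0 < M.maxEigenvalue ω) (i : Fin m₁) :
    M.marginal ω x i ≤ m₁ * M.normEigenvalue ω i := by
  have := Finset.sum_le_card_nsmul Finset.univ (M.sim ω x i) _
    fun j _ => M.sim_le_normEigenvalue ω hx hpos i j
  simpa [marginal] using this

theorem le_marginal {ε : ℝ} {i : Fin m₁} (h : ∀ j ∈ J₁, M.EpsSimilar ω x ε i j) :
    J₁.card * (1 - ε / 2) ≤ M.marginal ω x i := by
  have h1 := Finset.card_nsmul_le_sum J₁ (M.sim ω x i) _ h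
  rw [nsmul_eq_mul] at h1
  exact h1.trans (Finset.sum_le_sum_of_subset_of_nonneg (Finset.subset_univ _)
    fun j _ _ => M.sim_nonneg ω i j)

end Deterministic

end TriclusterModel

end MultiSlice

/-! ### The separation theorem -/

theorem corollary1 (c K : ℝ) (hc : 0 < c) (hK : 0 < K) :
    ∃ c₁ : ℝ, 0 < c₁ ∧
      ∀ (m₁ m₂ m₃ : ℕ) (J₁ : Finset (Fin m₁)) (J₂ : Finset (Fin m₂)) (J₃ : Finset (Fin m₃))
        (Ω : Type*) [MeasurableSpace Ω] (P : Measure Ω) [IsProbabilityMeasure P]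
        (M : MultiSlice.TriclusterModel P J₁ J₂ J₃) (ε : ℝ),
        J₁.card < m₁ → 0 < ε →
        Real.log (m₁ : ℝ) ≤ K * ((m₂ : ℝ) + (m₃ : ℝ)) →
        ∃ E : Set Ω, MeasurableSet E ∧
          1 - Real.exp 1 * ((m₁ : ℝ) - (J₁.card : ℝ)) ^ (-c₁) ≤ P.real E ∧
          ∀ ω ∈ E, ∀ x : Fin m₁ → EuclideanSpace ℝ (Fin m₃),
            (∀ i, MultiSlice.IsTopEigenvector (M.sliceCov ω i) (x i)) →
            c * (MultiSlice.wishartMu m₂ m₃ * (m₁ : ℝ)) ≤ M.maxEigenvalue ω →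
            (∀ i ∈ J₁, ∀ j ∈ J₁, M.EpsSimilar ω x ε i j) →
            (J₁.card : ℝ) * (1 - ε / 2 - 1 / (m₁ : ℝ))
                - √(Real.log ((m₁ : ℝ) - (J₁.card : ℝ)))
              ≤ MultiSlice.setDist {d | ∃ i ∈ J₁, d = M.marginal ω x i}
                  {d | ∃ i ∉ J₁, d = M.marginal ω x i} := by
  -- With n = m₂ + m₃ and t² = L² n, the exponent t² / 2 = (2 + 2K) n pays 2n for the nets (5 ≤ e²),
  -- K n for the union over slices, and K n for the decay in p = m₁ - l.
  set L : ℝ := √(4 + 4 * K) with hL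
  have hL2 : L ^ 2 = 4 + 4 * K := Real.sq_sqrt (by positivity)
  set B : ℝ := 32 * L ^ 2 / c with hB
  have hB0 : 0 < B := by rw [hB, hL2]; positivity
  refine ⟨1 / (1 + B ^ 2), by positivity, ?_⟩
  intro m₁ m₂ m₃ J₁ J₂ J₃ Ω _ P _ M ε hl hε hlog
  obtain ⟨i₀, j₀, k₀, hi₀, -, -⟩ := M.exists_mem
  have hm₂ : 0 < m₂ := Fin.pos j₀
  have hm₃ : 0 < m₃ := Fin.pos k₀
  have hm₁ : (0 : ℝ) < m₁ := by exact_mod_cast Fin.pos i₀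
  have hmu := MultiSlice.half_add_le_wishartMu hm₂ hm₃
  have hn0 : (0 : ℝ) < (m₂ : ℝ) + m₃ := by positivity
  have hmupos : 0 < MultiSlice.wishartMu m₂ m₃ := by linarith
  set p : ℝ := (m₁ : ℝ) - J₁.card with hp
  have hp1 : 1 ≤ p := by
    have : ((J₁.card : ℝ)) + 1 ≤ m₁ := by exact_mod_cast hl
    linarith
  have hp0 : 0 < p := by linarith
  have hpm : p ≤ m₁ := by
    have : (0 : ℝ) ≤ J₁.card := by positivity
    linarith
  have hplog : 0 ≤ Real.log p := Real.log_nonneg hp1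
  by_cases hsmall : Real.log p < B ^ 2
  -- Here c₁ log p ≤ 1, so e p^(-c₁) ≥ 1 and the empty event suffices.
  · refine ⟨∅, MeasurableSet.empty, ?_, by simp⟩
    rw [measureReal_empty, Real.rpow_def_of_pos hp0, ← Real.exp_add, sub_nonpos]
    refine Real.one_le_exp ?_
    have : Real.log p * (1 / (1 + B ^ 2)) ≤ 1 := by
      rw [mul_one_div, div_le_one (by positivity)]
      linarith
    linarith
  · rw [not_lt] at hsmall
    set t : ℝ := L * √((m₂ : ℝ) + m₃)
    have ht0 : 0 ≤ t := by positivity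
    have ht2 : t ^ 2 = (4 + 4 * K) * ((m₂ : ℝ) + m₃) := by
      rw [mul_pow, hL2, Real.sq_sqrt hn0.le]
    obtain ⟨E, hE, hPE, hEb⟩ := M.exists_event_norm_slice_le ht0
    refine ⟨E, hE, le_trans (sub_le_sub_left ?_ 1) hPE, ?_⟩
    · have h5 : (5 : ℝ) ^ (m₂ + m₃) ≤ Real.exp (2 * ((m₂ : ℝ) + m₃)) := by
        have h5' : (5 : ℝ) ≤ Real.exp 2 := by
          have h := Real.quadratic_le_exp_of_nonneg (x := 2) (by norm_num)
          norm_num at h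
          exact h
        calc (5 : ℝ) ^ (m₂ + m₃) ≤ Real.exp 2 ^ (m₂ + m₃) := by gcongr
          _ = Real.exp (2 * ((m₂ : ℝ) + m₃)) := by
            rw [← Real.exp_nat_mul]
            push_cast
            ring_nf
      have hlogp : Real.log p ≤ K * ((m₂ : ℝ) + m₃) := (Real.log_le_log hp0 hpm).trans hlog
      calc p * (5 ^ (m₂ + m₃) * Real.exp (-t ^ 2 / 2))
          ≤ Real.exp (Real.log p) *
              (Real.exp (2 * ((m₂ : ℝ) + m₃)) * Real.exp (-t ^ 2 / 2)) := by
            rw [Real.exp_log hp0]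
            gcongr
        _ ≤ Real.exp (1 + Real.log p * -(1 / (1 + B ^ 2))) := by
            rw [← Real.exp_add, ← Real.exp_add, Real.exp_le_exp, ht2]
            have : Real.log p * (1 / (1 + B ^ 2)) ≤ Real.log p := by
              refine mul_le_of_le_one_right hplog ?_
              rw [div_le_one (by positivity)]
              nlinarith
            nlinarith
        _ = Real.exp 1 * p ^ (-(1 / (1 + B ^ 2))) := by
            rw [Real.exp_add, Real.rpow_def_of_pos hp0]
    · intro ω hω x hx hmax hsim
      have hcm : 0 < c * (MultiSlice.wishartMu m₂ m₃ * (m₁ : ℝ)) := by positivity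
      have hpos : 0 < M.maxEigenvalue ω := hcm.trans_le hmax
      have hout : ∀ j ∉ J₁, M.marginal ω x j ≤ B := by
        intro j hj
        have h1 := hEb ω hω j hj (x j)
        rw [(hx j).1, mul_one] at h1
        have h2 : MultiSlice.topEigenvalue (M.sliceCov ω j)
            ≤ 32 * L ^ 2 * MultiSlice.wishartMu m₂ m₃ := by
          rw [M.topEigenvalue_sliceCov ω hx]
          calc _ ≤ (4 * t) ^ 2 := by gcongr
            _ = 32 * L ^ 2 * (((m₂ : ℝ) + m₃) / 2) := by rw [mul_pow, ht2, hL2]; ring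
            _ ≤ _ := by gcongr
        have h3 : M.normEigenvalue ω j ≤ B / m₁ := by
          calc M.normEigenvalue ω j
              ≤ 32 * L ^ 2 * MultiSlice.wishartMu m₂ m₃
                  / (c * (MultiSlice.wishartMu m₂ m₃ * (m₁ : ℝ))) := by
                unfold MultiSlice.TriclusterModel.normEigenvalue
                gcongr
            _ = B / m₁ := by
                rw [hB]
                field_simp
        calc M.marginal ω x j ≤ m₁ * M.normEigenvalue ω j := M.marginal_le ω hx hpos j
          _ ≤ m₁ * (B / m₁) := by gcongr
          _ = B := by field_simp
      have hBlog : B ≤ √(Real.log p) := Real.le_sqrt_of_sq_le hsmall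
      obtain ⟨j₁, hj₁⟩ : ∃ j, j ∉ J₁ := by
        by_contra! h
        rw [Finset.eq_univ_iff_forall.2 h] at hl
        simp at hl
      refine le_csInf ⟨_, _, ⟨i₀, hi₀, rfl⟩, _, ⟨j₁, hj₁, rfl⟩, rfl⟩ ?_
      rintro _ ⟨_, ⟨i, hi, rfl⟩, _, ⟨j, hj, rfl⟩, rfl⟩
      have h1 := M.le_marginal ω (hsim i hi)
      have h2 := hout j hj
      -- The term l / m₁ in the claim is pure slack.
      have h3 : 0 ≤ (J₁.card : ℝ) * (1 / (m₁ : ℝ)) := by positivity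
      refine le_trans ?_ (le_abs_self _)
      linarith
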